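/- Let $\mathrm{Ai}$ be the Airy function, i.e. the entire function $$\mathrm{Ai}(z)=\frac{1}{2\pi i}\int_{1-i\infty}^{1+i\infty} e^{t^3/3-zt}\,dt ,\qquad z\in\mathbb{C},$$ and let $\mathrm{Ai}'$ be its complex derivative. The function $\sqrt{z}\,\mathrm{Ai}(z)-\mathrm{Ai}'(z)$ is non-zero for all $z=re^{i\theta}$ with $r\ge 0$ and $|\theta|\le\pi$, where $\sqrt z=\sqrt r\,e^{i\theta/2}$. In other words, for all real $r\ge 0$ and all real $\theta$ with $|\theta|\le\pi$, $$\sqrt{r}\,e^{i\theta/2}\,\mathrm{Ai}(re^{i\theta})-\mathrm{Ai}'(re^{i\theta})\neq 0 .$$ Here the two sides $re^{\pm i\pi}$ of the negative real axis are regarded as different, with $\sqrt z=\pm i\sqrt r$ respectively. -/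

import Mathlib

/-- The Airy function `Ai`, as an entire function on `ℂ`, given by the classical contour integral
`Ai z = (1 / (2 π i)) ∫ exp (t ^ 3 / 3 - z * t) dt`, taken upwards along the vertical line
`t = 1 + i y`, `y ∈ ℝ`. On that line the integrand has modulus
`exp (1 / 3 - y ^ 2 - Re z + y * Im z)`, so the integral converges absolutely for every `z`;
the factor `i` of `dt = i dy` cancels the one in `2 π i`. -/
noncomputable def airyAi (z : ℂ) : ℂ :=
  (1 / (2 * (Real.pi : ℂ))) *
    ∫ y : ℝ, Complex.exp ((1 + (y : ℂ) * Complex.I) ^ 3 / 3 - z * (1 + (y : ℂ) * Complex.I))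

/-! Up to the factor `1 / (2π)`, `Ai` and `-Ai'` are the moments `M₀` and `M₁`, with `M₀' = -M₁` and
`M₁' = -z M₀`. With `z = w ^ 2`, `Re w ≥ 0`, a zero would give `M₁ z = -w M₀ z`. Follow `G x = M₁ *
conj M₀` at `z + x` for real `x ≥ 0`: it tends to 0, starts at `-w |M₀ z|²`, and `G' = -((z + x)
|M₀|² + |M₁|²)`. For real `w` use `Re G`, otherwise `Im w * Im G`: each is nonincreasing, starts at
or below 0 and tends to 0, hence vanishes on the ray. This contradicts
`exists_airyMoment_zero_ne_zero` or `airyMoment_one_ne_zero`. -/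

/-- The function `t ^ k exp (t ^ 3 / 3 - z t)` on the line `t = 1 + i y`. -/
noncomputable def airyIntegrand (k : ℕ) (z : ℂ) (y : ℝ) : ℂ :=
  (1 + (y : ℂ) * Complex.I) ^ k *
    Complex.exp ((1 + (y : ℂ) * Complex.I) ^ 3 / 3 - z * (1 + (y : ℂ) * Complex.I))

/-- The moments `∫ t ^ k exp (t ^ 3 / 3 - z t) dy` along the line `t = 1 + i y`. -/
noncomputable def airyMoment (k : ℕ) (z : ℂ) : ℂ := ∫ y : ℝ, airyIntegrand k z y

theorem continuous_airyIntegrand (k : ℕ) (z : ℂ) : Continuous (airyIntegrand k z) := by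
  unfold airyIntegrand
  fun_prop

theorem airyExponent_re (z : ℂ) (y : ℝ) :
    ((1 + (y : ℂ) * Complex.I) ^ 3 / 3 - z * (1 + (y : ℂ) * Complex.I)).re =
      1 / 3 - y ^ 2 - z.re + y * z.im := by
  have h : (1 + (y : ℂ) * Complex.I) ^ 3 / 3 =
      ((1 / 3 - y ^ 2 : ℝ) : ℂ) + ((y - y ^ 3 / 3 : ℝ) : ℂ) * Complex.I := by
    push_cast
    linear_combination ((y : ℂ) ^ 2 + y ^ 3 / 3 * Complex.I) * Complex.I_sq
  rw [h]
  simp only [Complex.sub_re, Complex.add_re, Complex.ofReal_re, Complex.mul_re, Complex.I_re,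
    Complex.I_im, Complex.ofReal_im, Complex.one_re, Complex.add_im, Complex.one_im, Complex.mul_im]
  ring

/-- Half of the decay `-y²` absorbs the terms linear in `|y|`, by completing the square. -/
theorem norm_airyIntegrand_le (k : ℕ) (z : ℂ) (y : ℝ) :
    ‖airyIntegrand k z y‖ ≤
      Real.exp (1 / 3 - z.re + (|z.im| + k) ^ 2 / 2) * Real.exp (-(1 / 2) * y ^ 2) := by
  have h1 : ‖(1 + (y : ℂ) * Complex.I)‖ ≤ Real.exp |y| := by
    calc ‖(1 + (y : ℂ) * Complex.I)‖ ≤ ‖(1 : ℂ)‖ + ‖(y : ℂ) * Complex.I‖ := norm_add_le _ _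
      _ = |y| + 1 := by simp [add_comm]
      _ ≤ _ := Real.add_one_le_exp _
  have h2 : ‖(1 + (y : ℂ) * Complex.I)‖ ^ k ≤ Real.exp (k * |y|) := by
    rw [Real.exp_nat_mul]
    exact pow_le_pow_left₀ (norm_nonneg _) h1 k
  rw [airyIntegrand, norm_mul, norm_pow, Complex.norm_exp, airyExponent_re, ← Real.exp_add]
  refine (mul_le_mul_of_nonneg_right h2 (Real.exp_nonneg _)).trans ?_
  rw [← Real.exp_add, Real.exp_le_exp]
  have h3 : y * z.im ≤ |y| * |z.im| := by rw [← abs_mul]; exact le_abs_self _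
  nlinarith [sq_nonneg (|y| - (|z.im| + k)), sq_abs y]

theorem integrable_gaussian_half :
    MeasureTheory.Integrable fun y : ℝ => Real.exp (-(1 / 2) * y ^ 2) :=
  integrable_exp_neg_mul_sq (by norm_num)

theorem integrable_airyIntegrand (k : ℕ) (z : ℂ) :
    MeasureTheory.Integrable (airyIntegrand k z) :=
  (integrable_gaussian_half.const_mul _).mono'
    (continuous_airyIntegrand k z).aestronglyMeasurable
    (.of_forall fun y => norm_airyIntegrand_le k z y)

theorem norm_airyMoment_le (k : ℕ) (z : ℂ) :
    ‖airyMoment k z‖ ≤ Real.exp (1 / 3 - z.re + (|z.im| + k) ^ 2 / 2) *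
      ∫ y : ℝ, Real.exp (-(1 / 2) * y ^ 2) := by
  rw [← MeasureTheory.integral_const_mul]
  exact MeasureTheory.norm_integral_le_of_norm_le (integrable_gaussian_half.const_mul _)
    (.of_forall fun y => norm_airyIntegrand_le k z y)

theorem hasDerivAt_airyMoment (k : ℕ) (z : ℂ) :
    HasDerivAt (airyMoment k) (-airyMoment (k + 1) z) z := by
  have hb : MeasureTheory.Integrable fun y : ℝ =>
      Real.exp (1 / 3 + (‖z‖ + 1) + (‖z‖ + 1 + (k + 1 : ℕ)) ^ 2 / 2) *
        Real.exp (-(1 / 2) * y ^ 2) := integrable_gaussian_half.const_mul _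
  have h := (hasDerivAt_integral_of_dominated_loc_of_deriv_le
    (μ := MeasureTheory.volume) (F := airyIntegrand k)
    (F' := fun z y => -airyIntegrand (k + 1) z y) (x₀ := z) (s := Metric.ball z 1)
    (Metric.ball_mem_nhds z one_pos)
    (.of_forall fun x => (continuous_airyIntegrand k x).aestronglyMeasurable)
    (integrable_airyIntegrand k z)
    (continuous_airyIntegrand (k + 1) z).neg.aestronglyMeasurable
    (.of_forall fun y x hx => ?_) hb (.of_forall fun y x _ => ?_)).2
  · rwa [MeasureTheory.integral_neg] at h
  · have hx' : ‖x‖ ≤ ‖z‖ + 1 := by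
      have := norm_sub_norm_le x z
      rw [mem_ball_iff_norm] at hx
      linarith
    rw [norm_neg]
    refine (norm_airyIntegrand_le (k + 1) x y).trans ?_
    have h1 := Complex.abs_re_le_norm x
    have h2 := Complex.abs_im_le_norm x
    have h3 := neg_abs_le x.re
    gcongr <;> linarith
  · have h1 : HasDerivAt (fun x : ℂ => (1 + (y : ℂ) * Complex.I) ^ 3 / 3 -
        x * (1 + (y : ℂ) * Complex.I)) (-(1 + (y : ℂ) * Complex.I)) x := by
      simpa using ((hasDerivAt_id x).mul_const (1 + (y : ℂ) * Complex.I)).const_sub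
        ((1 + (y : ℂ) * Complex.I) ^ 3 / 3)
    refine (h1.cexp.const_mul ((1 + (y : ℂ) * Complex.I) ^ k)).congr_deriv ?_
    rw [airyIntegrand]
    ring

/-- The Airy equation: `(t² - z) exp(t³/3 - zt)` is an exact derivative along the line. -/
theorem airyMoment_two (z : ℂ) : airyMoment 2 z = z * airyMoment 0 z := by
  have hd (y : ℝ) : HasDerivAt (airyIntegrand 0 z)
      (Complex.I * (airyIntegrand 2 z y - z * airyIntegrand 0 z y)) y := by
    have h0 : HasDerivAt (fun y : ℝ => 1 + (y : ℂ) * Complex.I) Complex.I y := by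
      simpa using ((Complex.ofRealCLM.hasDerivAt (x := y)).mul_const Complex.I).const_add 1
    have h1 := (((h0.pow 3).div_const 3).sub (h0.const_mul z)).cexp
    refine (h1.congr_deriv ?_).congr_of_eventuallyEq (.of_forall fun x => ?_)
    · simp only [airyIntegrand, Pi.pow_apply, Pi.sub_apply]
      push_cast
      ring
    · simp [airyIntegrand]
  have h2 := integrable_airyIntegrand 2 z
  have h0 := integrable_airyIntegrand 0 z
  have h := MeasureTheory.integral_eq_zero_of_hasDerivAt_of_integrable hd
    ((h2.sub (h0.const_mul z)).const_mul _) h0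
  rw [MeasureTheory.integral_const_mul, MeasureTheory.integral_sub h2 (h0.const_mul z),
    MeasureTheory.integral_const_mul] at h
  exact sub_eq_zero.mp ((mul_eq_zero.mp h).resolve_left Complex.I_ne_zero)

theorem tendsto_airyMoment_add (k : ℕ) (z : ℂ) :
    Filter.Tendsto (fun x : ℝ => airyMoment k (z + x)) Filter.atTop (nhds 0) := by
  refine squeeze_zero_norm (fun x => norm_airyMoment_le k (z + x)) ?_
  rw [← zero_mul (∫ y : ℝ, Real.exp (-(1 / 2) * y ^ 2))]
  refine Filter.Tendsto.mul_const _ (Real.tendsto_exp_atBot.comp ?_)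
  simp only [Complex.add_re, Complex.ofReal_re, Complex.add_im, Complex.ofReal_im, add_zero]
  refine Filter.tendsto_atBot_add_const_right _ _ ?_
  refine Filter.tendsto_neg_atTop_atBot.comp (Filter.tendsto_atTop_add_const_left _ (z.re - 1 / 3)
    Filter.tendsto_id) |>.congr fun x => ?_
  simp only [Function.comp, id]
  ring

/-- At `z = 2πξ` the moment is `exp(-2πξ)` times a Fourier transform, so Fourier inversion would
kill a nonvanishing integrand. -/
theorem airyMoment_zero_ne_zero : ∃ z, airyMoment 0 z ≠ 0 := by
  by_contra! h
  have hF : FourierTransform.fourier (airyIntegrand 0 0) = 0 := by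
    funext ξ
    rw [Real.fourier_real_eq_integral_exp_smul]
    have h1 := congrArg (Complex.exp (2 * Real.pi * ξ) * ·) (h (2 * Real.pi * ξ))
    simp only [airyMoment, ← MeasureTheory.integral_const_mul, mul_zero] at h1
    refine Eq.trans ?_ h1
    refine MeasureTheory.integral_congr_ae (.of_forall fun y => ?_)
    simp only [airyIntegrand, pow_zero, one_mul, smul_eq_mul, ← Complex.exp_add]
    congr 1
    push_cast
    ring
  have h2 := (continuous_airyIntegrand 0 0).fourierInv_fourier_eq (integrable_airyIntegrand 0 0)
    (by rw [hF]; exact MeasureTheory.integrable_zero _ _ _)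
  rw [hF] at h2
  have h3 := congrFun h2 0
  rw [Real.fourierInv_eq'] at h3
  simp [airyIntegrand] at h3
  exact Complex.exp_ne_zero _ h3.symm

/-- The zeroth moment cannot vanish on a horizontal segment. -/
theorem exists_airyMoment_zero_ne_zero (z : ℂ) :
    ∃ x ∈ Set.Ioo (0 : ℝ) 1, airyMoment 0 (z + x) ≠ 0 := by
  by_contra! h
  obtain ⟨a, ha⟩ := airyMoment_zero_ne_zero
  have hd : DifferentiableOn ℂ (airyMoment 0) Set.univ :=
    fun x _ => (hasDerivAt_airyMoment 0 x).differentiableAt.differentiableWithinAt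
  have hA := hd.analyticOnNhd isOpen_univ
  refine ha (hA.eqOn_zero_of_preconnected_of_frequently_eq_zero isPreconnected_univ
    (Set.mem_univ (z + (1 / 2 : ℝ))) ?_ (Set.mem_univ a))
  have ht : Filter.Tendsto (fun x : ℝ => z + (x : ℂ)) (nhdsWithin (1 / 2) {1 / 2}ᶜ)
      (nhdsWithin (z + (1 / 2 : ℝ)) {z + (1 / 2 : ℝ)}ᶜ) := by
    refine tendsto_nhdsWithin_iff.mpr ⟨?_, ?_⟩
    · exact (Continuous.tendsto (by fun_prop : Continuous fun x : ℝ => z + (x : ℂ)) _).mono_left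
        nhdsWithin_le_nhds
    · filter_upwards [self_mem_nhdsWithin] with x hx
      simpa only [Set.mem_compl_iff, Set.mem_singleton_iff, add_right_inj, Complex.ofReal_inj] using hx
  refine ht.frequently (Filter.Eventually.frequently ?_)
  filter_upwards [nhdsWithin_le_nhds (Ioo_mem_nhds (by norm_num : (0 : ℝ) < 1 / 2)
    (by norm_num : (1 / 2 : ℝ) < 1))] with x hx using h x hx

theorem eq_zero_of_antitone_tendsto_zero {f p : ℝ → ℝ} (hf : ∀ x, HasDerivAt f (-p x) x)
    (hp : ∀ x, 0 ≤ x → 0 ≤ p x) (hlim : Filter.Tendsto f Filter.atTop (nhds 0)) (h0 : f 0 ≤ 0) :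
    f 0 = 0 ∧ ∀ x, 0 < x → p x = 0 := by
  have hanti : AntitoneOn f (Set.Ici 0) := by
    refine antitoneOn_of_hasDerivWithinAt_nonpos (convex_Ici 0)
      (fun x _ => (hf x).continuousAt.continuousWithinAt)
      (fun x _ => (hf x).hasDerivWithinAt) fun x hx => ?_
    rw [interior_Ici] at hx
    exact neg_nonpos.mpr (hp x (le_of_lt hx))
  have hzero : ∀ y, 0 ≤ y → f y = 0 := fun y hy => by
    refine le_antisymm ((hanti Set.self_mem_Ici hy hy).trans h0) ?_
    refine le_of_tendsto hlim ?_
    filter_upwards [Filter.eventually_ge_atTop y] with t ht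
      using hanti hy (Set.mem_Ici.mpr (hy.trans ht)) ht
  refine ⟨hzero 0 le_rfl, fun x hx => ?_⟩
  have h1 : HasDerivAt f 0 x := (hasDerivAt_const x (0 : ℝ)).congr_of_eventuallyEq (by
    filter_upwards [Ioi_mem_nhds hx] with t ht using hzero t (le_of_lt ht))
  simpa using (hf x).unique h1

theorem hasDerivAt_airyMoment_add (k : ℕ) (z : ℂ) (x : ℝ) :
    HasDerivAt (fun x : ℝ => airyMoment k (z + x)) (-airyMoment (k + 1) (z + x)) x := by
  have h : HasDerivAt (fun x : ℝ => z + (x : ℂ)) 1 x := by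
    simpa using (Complex.ofRealCLM.hasDerivAt (x := x)).const_add z
  refine ((hasDerivAt_airyMoment k (z + x)).comp x h).congr_deriv (mul_one _)

/-- The first two moments have no common zero. -/
theorem airyMoment_one_ne_zero {z : ℂ} (h0 : airyMoment 0 z = 0) : airyMoment 1 z ≠ 0 := by
  intro h1
  have hd (x : ℝ) := (hasDerivAt_airyMoment_add 0 z x).prodMk (hasDerivAt_airyMoment_add 1 z x)
  obtain ⟨x, hx, hne⟩ := exists_airyMoment_zero_ne_zero z
  -- Grönwall for the pair `(M₀, M₁)` in the sup norm; `‖z‖ + 1` bounds both 1 and `‖z + x‖` on the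
  -- unit segment.
  have h := eq_zero_of_abs_deriv_le_mul_abs_self_of_eq_zero_right (K := ‖z‖ + 1) (a := 0) (b := 1)
    (fun x _ => (hd x).continuousAt.continuousWithinAt)
    (fun x _ => (hd x).hasDerivWithinAt) (by simp [h0, h1]) (fun x hx => ?_) x
    (Set.Ioo_subset_Icc_self hx)
  · exact hne (congrArg Prod.fst h)
  · have hzx : ‖z + x‖ ≤ ‖z‖ + 1 := (norm_add_le _ _).trans (by
      simpa [abs_of_nonneg hx.1] using hx.2.le)
    simp only [zero_add, one_add_one_eq_two, airyMoment_two]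
    refine max_le ?_ ?_
    · rw [norm_neg]
      exact (le_max_right _ _).trans (le_mul_of_one_le_left
        ((norm_nonneg _).trans (le_max_right _ _)) (by linarith [norm_nonneg z]))
    · rw [norm_neg, norm_mul]
      gcongr
      exact le_max_left _ _

theorem hasDerivAt_airyMoment_mul_star (z : ℂ) (x : ℝ) :
    HasDerivAt (fun x : ℝ => airyMoment 1 (z + x) * star (airyMoment 0 (z + x)))
      (-((z + x) * (‖airyMoment 0 (z + x)‖ ^ 2 : ℝ) + (‖airyMoment 1 (z + x)‖ ^ 2 : ℝ))) x := by
  refine ((hasDerivAt_airyMoment_add 1 z x).mul (hasDerivAt_airyMoment_add 0 z x).star).congr_deriv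
    ?_
  simp only [one_add_one_eq_two, airyMoment_two, zero_add, star_neg, ← Complex.normSq_eq_norm_sq,
    Complex.normSq_eq_conj_mul_self, Complex.star_def]
  ring

theorem tendsto_airyMoment_mul_star (z : ℂ) :
    Filter.Tendsto (fun x : ℝ => airyMoment 1 (z + x) * star (airyMoment 0 (z + x)))
      Filter.atTop (nhds 0) := by
  simpa using (tendsto_airyMoment_add 1 z).mul (tendsto_airyMoment_add 0 z).star

theorem mul_airyMoment_zero_add_airyMoment_one_ne_zero {w : ℂ} (hw : 0 ≤ w.re) :
    w * airyMoment 0 (w ^ 2) + airyMoment 1 (w ^ 2) ≠ 0 := by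
  intro h
  set z := w ^ 2 with hz
  have h1 : airyMoment 1 z = -w * airyMoment 0 z := by linear_combination h
  have hG0 : airyMoment 1 (z + (0 : ℝ)) * star (airyMoment 0 (z + (0 : ℝ))) =
      -(w * (‖airyMoment 0 z‖ ^ 2 : ℝ)) := by
    rw [Complex.ofReal_zero, add_zero, h1, ← Complex.normSq_eq_norm_sq,
      Complex.normSq_eq_conj_mul_self, Complex.star_def]
    ring
  obtain ⟨x, hx, hne⟩ := exists_airyMoment_zero_ne_zero z
  have hd := hasDerivAt_airyMoment_mul_star z
  have hlim := tendsto_airyMoment_mul_star z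
  have him : z.im = 2 * w.re * w.im := by rw [hz, pow_two, Complex.mul_im]; ring
  have hre : z.re = w.re ^ 2 - w.im ^ 2 := by rw [hz, pow_two, Complex.mul_re]; ring
  by_cases hwim : w.im = 0
  · have hre0 : 0 ≤ z.re := by rw [hre, hwim]; nlinarith
    have hp := (eq_zero_of_antitone_tendsto_zero
      (p := fun x => (z.re + x) * ‖airyMoment 0 (z + x)‖ ^ 2 + ‖airyMoment 1 (z + x)‖ ^ 2)
      (fun x => (Complex.reCLM.hasFDerivAt.comp_hasDerivAt x (hd x)).congr_deriv
        (by
        simp only [Complex.reCLM_apply, Complex.neg_re, Complex.add_re, Complex.re_mul_ofReal,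
          Complex.ofReal_re]))
      (fun x hx => by positivity)
      (by simpa using (Complex.reCLM.continuous.tendsto 0).comp hlim)
      (by
        simp only [Function.comp, hG0, Complex.reCLM_apply, Complex.neg_re, Complex.re_mul_ofReal]
        exact neg_nonpos.mpr (by positivity))).2 x hx.1
    have h3 : 0 < (z.re + x) * ‖airyMoment 0 (z + x)‖ ^ 2 := by
      have := norm_pos_iff.mpr hne
      have := hx.1
      positivity
    nlinarith [sq_nonneg ‖airyMoment 1 (z + x)‖]
  -- The factor `w.im` fixes the sign, since `w.im * z.im = 2 * w.re * w.im ^ 2 ≥ 0`.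
  · have hp := (eq_zero_of_antitone_tendsto_zero
      (f := fun x : ℝ => w.im * (airyMoment 1 (z + x) * star (airyMoment 0 (z + x))).im)
      (p := fun x => w.im * (z.im * ‖airyMoment 0 (z + x)‖ ^ 2))
      (fun x => ((Complex.imCLM.hasFDerivAt.comp_hasDerivAt x (hd x)).const_mul w.im).congr_deriv
        (by
        simp only [Complex.imCLM_apply, Complex.neg_im, Complex.add_im, Complex.im_mul_ofReal,
          Complex.ofReal_im, add_zero, mul_neg]))
      (fun x hx => by
        rw [him]
        have : 0 ≤ 2 * w.re * (w.im ^ 2 * ‖airyMoment 0 (z + x)‖ ^ 2) := by positivity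
        nlinarith)
      (by simpa using ((Complex.imCLM.continuous.tendsto 0).comp hlim).const_mul w.im)
      (by
        simp only [hG0, Complex.neg_im, Complex.im_mul_ofReal]
        nlinarith [mul_nonneg (sq_nonneg w.im) (sq_nonneg ‖airyMoment 0 z‖)])).1
    simp only [hG0, Complex.neg_im, Complex.im_mul_ofReal] at hp
    have h0 : airyMoment 0 z = 0 := by simpa [hwim] using hp
    exact airyMoment_one_ne_zero h0 (by rw [h1, h0, mul_zero])

theorem airyAi_eq (z : ℂ) : airyAi z = 1 / (2 * (Real.pi : ℂ)) * airyMoment 0 z := by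
  simp only [airyAi, airyMoment, airyIntegrand, pow_zero, one_mul]

theorem deriv_airyAi (z : ℂ) : deriv airyAi z = -(1 / (2 * (Real.pi : ℂ)) * airyMoment 1 z) := by
  rw [funext airyAi_eq, ((hasDerivAt_airyMoment 0 z).const_mul _).deriv, zero_add, mul_neg]

/-- For `z = r e^{iθ}` the square root is `√r e^{iθ/2}`: the principal root when `|θ| < π`, and its
one-sided limits `± i √r` on the upper and lower side of the negative axis when `θ = ± π`. -/
theorem mainTheorem10 (r θ : ℝ) (hr : 0 ≤ r) (hθ : |θ| ≤ Real.pi) :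
    ((Real.sqrt r : ℂ) * Complex.exp ((θ : ℂ) / 2 * Complex.I)) *
        airyAi ((r : ℂ) * Complex.exp ((θ : ℂ) * Complex.I)) -
      deriv airyAi ((r : ℂ) * Complex.exp ((θ : ℂ) * Complex.I)) ≠ 0 := by
  set w : ℂ := (Real.sqrt r : ℂ) * Complex.exp ((θ : ℂ) / 2 * Complex.I) with hw
  have hw2 : (r : ℂ) * Complex.exp ((θ : ℂ) * Complex.I) = w ^ 2 := by
    rw [hw, mul_pow, ← Complex.ofReal_pow, Real.sq_sqrt hr, ← Complex.exp_nat_mul]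
    congr 2
    push_cast
    ring
  have hwre : 0 ≤ w.re := by
    have h : (θ : ℂ) / 2 * Complex.I = ((θ / 2 : ℝ) : ℂ) * Complex.I := by push_cast; rfl
    rw [hw, h, Complex.re_ofReal_mul, Complex.exp_ofReal_mul_I_re]
    obtain ⟨h1, h2⟩ := abs_le.mp hθ
    exact mul_nonneg (Real.sqrt_nonneg r)
      (Real.cos_nonneg_of_mem_Icc ⟨by linarith, by linarith⟩)
  rw [hw2, airyAi_eq, deriv_airyAi]
  intro h
  have hc : 1 / (2 * (Real.pi : ℂ)) ≠ 0 := by simp [Real.pi_ne_zero]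
  refine mul_airyMoment_zero_add_airyMoment_one_ne_zero hwre
    ((mul_eq_zero.mp ?_).resolve_left hc)
  linear_combination h
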